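/- Let $X_0, X_1, \dots$ be independent complex random variables such that, for some $\alpha\in\mathbb{C}$, $$\mathbb{E} X_j = 0,\qquad \mathbb{E} X_j^2 = \alpha,\qquad \mathbb{E}|X_j|^2 = 1\qquad\text{for all } j\ge 0,$$ and suppose that the Lindeberg condition $$\lim_{n\to\infty}\frac1n\sum_{j=0}^{n-1}\mathbb{E}\bigl(|X_j|^2\,1_{|X_j|>\varepsilon\sqrt n}\bigr)=0\qquad\text{for every }\varepsilon>0$$ holds. Let $\mathcal{C}_n$ be the $n\times n$ circulant matrix with first row $X_0,\dots,X_{n-1}$, that is, with $(i,j)$ entry $X_{(j-i)\bmod n}$, and let $\mu_n=\frac1n\sum_{k=0}^{n-1}\delta_{\lambda_k}$ be the empirical spectral measure of $n^{-1/2}\mathcal{C}_n$, where $\lambda_0,\dots,\lambda_{n-1}$ are the eigenvalues of $n^{-1/2}\mathcal{C}_n$ counted with multiplicity. Let $\gamma_{\mathbb{C}}$ be the standard complex Gaussian measure, with density $\frac1\pi e^{-|z|^2}$ with respect to Lebesgue measure on $\mathbb{C}$. Then each $\mu_n$ is a random measure (it depends measurably on the outcome), and $\mu_n$ converges to $\gamma_{\mathbb{C}}$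 in expectation and weak-$*$ in probability: for every bounded continuous $f:\mathbb{C}\to\mathbb{R}$, $$\mathbb{E}\int f\,d\mu_n\longrightarrow\int f\,d\gamma_{\mathbb{C}}\qquad\text{and}\qquad \int f\,d\mu_n\longrightarrow\int f\,d\gamma_{\mathbb{C}}\ \text{ in probability, as } n\to\infty.$$ Moreover, for every measurable convex set $A\subseteq\mathbb{C}$, $$\mathbb{E}\,\mu_n(A)\longrightarrow\gamma_{\mathbb{C}}(A)\qquad\text{and}\qquad \mathbb{E}\bigl[\mu_n(A)^2\bigr]\longrightarrow\gamma_{\mathbb{C}}(A)^2,\qquad\text{as } n\to\infty.$$ -/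

import Mathlib

open MeasureTheory ProbabilityTheory Filter Topology
open scoped ENNReal BoundedContinuousFunction

noncomputable section

namespace RandomCirculant

/-- The `n × n` circulant matrix with first row `x 0, …, x (n - 1)`: its `(i, j)` entry is
`x ((j - i) mod n)`. -/
def circulantRow (n : ℕ) (x : ℕ → ℂ) : Matrix (Fin n) (Fin n) ℂ :=
  (Matrix.circulant fun k : Fin n => x k).transpose

/-- The empirical spectral measure `(1 / n) ∑ δ_λ`, where `λ` runs over the eigenvalues of `M`
counted with algebraic multiplicity. -/
def empiricalSpectralMeasure {n : ℕ} (M : Matrix (Fin n) (Fin n) ℂ) : Measure ℂ :=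
  (n : ℝ≥0∞)⁻¹ • (M.charpoly.roots.map fun l => Measure.dirac l).sum

/-- The empirical spectral measure of `n ^ (-1 / 2)` times the `n × n` circulant matrix whose
first row is `x 0, …, x (n - 1)`. -/
def circulantSpectralMeasure (n : ℕ) (x : ℕ → ℂ) : Measure ℂ :=
  empiricalSpectralMeasure (((Real.sqrt n : ℝ) : ℂ)⁻¹ • circulantRow n x)

/-- The standard complex Gaussian measure, with density `π⁻¹ exp (-|z|²)`. -/
def complexGaussian : Measure ℂ :=
  (volume : Measure ℂ).withDensity fun z => ENNReal.ofReal (Real.pi⁻¹ * Real.exp (-‖z‖ ^ 2))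

end RandomCirculant

end

/-!
The eigenvalues of the normalised circulant matrix are the discrete Fourier transforms
`λ_k = n ^ (-1 / 2) ∑ j, ζ ^ (j * k) * X j`, `ζ = exp (2πi / n)`. The whole theorem follows from one
weak limit: the law of `(λ_k, λ_l)` for independent uniform indices `k`, `l`, which is the measure
`𝔼 (μ_n ⊗ μ_n)` (`pairLaw`), converges to `γ ⊗ γ`.

* This convergence is proved with characteristic functions. By orthogonality of the characters of
  `ℤ / n`, for all but `O(n)` pairs the vector `(λ_k, λ_l)` has exactly the covariance of two
  independent standard complex Gaussians (`sum_variance_eq`, `card_not_nonresonant_le`), the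
  pseudo-variance `α` dropping out. For those pairs the characteristic function is close to the
  Gaussian one with an error that does not depend on the pair (`norm_integral_cexp_sum_sub_le`), and
  the remaining pairs contribute `O(1 / n)`.
* For bounded continuous `f` and `g`, integrating `f ⊗ g` against the pair law gives
  `𝔼 (∫ f dμ_n * ∫ g dμ_n)`. With `g = 1` this is convergence in expectation. With `g = f` it shows
  that the variance of `∫ f dμ_n` vanishes, and Chebyshev's inequality gives convergence in
  probability.
* For convex `A` and `B` the set `A × B` is convex, so its boundary is null for `γ ⊗ γ`, and the
  portmanteau theorem gives `𝔼 (μ_n(A) * μ_n(B)) → γ(A) * γ(B)`. The cases `B = ℂ` and `B = A` are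
  the two limits claimed.
-/

namespace RandomCirculant

open scoped ComplexConjugate

variable {Ω : Type*} [MeasurableSpace Ω]

/-! ### Lindeberg's estimate for characteristic functions -/

/-- Truncated Taylor estimate: below the threshold `δ` the cubic remainder is at most `δ` times the
quadratic term, above it the quadratic term alone controls the remainder. -/
lemma norm_cexp_mul_I_sub_le {y δ : ℝ} (hδ : 0 < δ) (hδ1 : δ ≤ 1) :
    ‖Complex.exp (y * Complex.I) - (1 + y * Complex.I - (y : ℂ) ^ 2 / 2)‖
      ≤ 4 * δ * y ^ 2 + 4 * (if δ < |y| then y ^ 2 else 0) := by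
  have hn : ‖(y : ℂ) * Complex.I‖ = |y| := by simp
  by_cases hy1 : |y| ≤ 1
  · have h3 : ‖Complex.exp (y * Complex.I) - (1 + y * Complex.I - (y : ℂ) ^ 2 / 2)‖
        ≤ 3 * |y| ^ 3 := by
      have h := Complex.norm_exp_sub_sum_le_norm_mul_exp (y * Complex.I) 3
      have hs : ∑ m ∈ Finset.range 3, ((y : ℂ) * Complex.I) ^ m / m.factorial
          = 1 + y * Complex.I - (y : ℂ) ^ 2 / 2 := by
        simp [Finset.sum_range_succ, Nat.factorial, mul_pow]
        ring
      rw [hs, hn] at h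
      refine h.trans ?_
      have he : Real.exp |y| ≤ 3 :=
        (Real.exp_le_exp.2 hy1).trans (Real.exp_one_lt_d9.le.trans (by norm_num))
      nlinarith [pow_nonneg (abs_nonneg y) 3]
    refine h3.trans ?_
    have hp : |y| ^ 3 = |y| * y ^ 2 := by rw [pow_succ', sq_abs]
    rw [hp]
    split_ifs with h
    · nlinarith [mul_nonneg (sub_nonneg.2 hy1) (sq_nonneg y), mul_nonneg hδ.le (sq_nonneg y)]
    · have := mul_nonneg (sub_nonneg.2 (not_lt.1 h)) (sq_nonneg y)
      nlinarith [mul_nonneg hδ.le (sq_nonneg y)]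
  · push Not at hy1
    rw [if_pos (hδ1.trans_lt hy1)]
    have h1 : ‖Complex.exp (y * Complex.I)‖ = 1 := Complex.norm_exp_ofReal_mul_I y
    have h2 : ‖(1 : ℂ) + y * Complex.I - (y : ℂ) ^ 2 / 2‖ ≤ 1 + |y| + y ^ 2 / 2 := by
      refine (norm_sub_le _ _).trans (add_le_add ((norm_add_le _ _).trans ?_) ?_)
      · simp
      · simp
    refine (norm_sub_le _ _).trans ?_
    rw [h1]
    have : |y| ^ 2 = y ^ 2 := sq_abs y
    nlinarith [mul_nonneg hδ.le (sq_nonneg y)]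

lemma abs_exp_neg_sub_one_add_le {x : ℝ} (hx : 0 ≤ x) : |Real.exp (-x) - (1 - x)| ≤ x ^ 2 := by
  have h0 : 1 - x ≤ Real.exp (-x) := Real.one_sub_le_exp_neg x
  rw [abs_of_nonneg (by linarith)]
  by_cases h1 : x ≤ 1
  · have := Real.abs_exp_sub_one_sub_id_le (x := -x) (by rwa [abs_neg, abs_of_nonneg hx])
    have := (abs_le.1 this).2
    nlinarith
  · have : Real.exp (-x) ≤ 1 := Real.exp_le_one_iff.2 (by linarith)
    nlinarith

/-- Lindeberg's estimate for one centred variable: its characteristic function at `1` is compared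
with that of the Gaussian of the same variance. -/
lemma norm_integral_cexp_sub_le (P : Measure Ω) [IsProbabilityMeasure P] {Y : Ω → ℝ}
    (hY : Measurable Y) (hmean : ∫ ω, Y ω ∂P = 0) (hL2 : MemLp Y 2 P)
    {δ : ℝ} (hδ : 0 < δ) (hδ1 : δ ≤ 1) :
    ‖∫ ω, Complex.exp (Y ω * Complex.I) ∂P
        - Complex.exp (-((∫ ω, Y ω ^ 2 ∂P : ℝ) : ℂ) / 2)‖
      ≤ 4 * δ * ∫ ω, Y ω ^ 2 ∂P + 4 * ∫ ω in {ω | δ < |Y ω|}, Y ω ^ 2 ∂P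
        + (∫ ω, Y ω ^ 2 ∂P) ^ 2 := by
  set v := ∫ ω, Y ω ^ 2 ∂P with hv
  have hv0 : 0 ≤ v := integral_nonneg fun ω => sq_nonneg _
  have hi1 : Integrable Y P := hL2.integrable (by norm_num)
  have hi2 : Integrable (fun ω => Y ω ^ 2) P := hL2.integrable_sq
  have hie : Integrable (fun ω => Complex.exp (Y ω * Complex.I)) P :=
    Integrable.of_bound (C := 1) (by fun_prop)
      (ae_of_all _ fun ω => (Complex.norm_exp_ofReal_mul_I _).le)
  have hiT : Integrable (fun ω => 1 + (Y ω : ℂ) * Complex.I - (Y ω : ℂ) ^ 2 / 2) P := by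
    have := hi2.ofReal (𝕜 := ℂ)
    refine (((integrable_const _).add (hi1.ofReal.mul_const _)).sub ?_)
    simpa using this.div_const 2
  have hT : ∫ ω, (1 + (Y ω : ℂ) * Complex.I - (Y ω : ℂ) ^ 2 / 2) ∂P = 1 - (v : ℂ) / 2 := by
    have h2 : Integrable (fun ω => (Y ω : ℂ) ^ 2 / 2) P := by
      simpa using (hi2.ofReal (𝕜 := ℂ)).div_const 2
    have h1 : Integrable (fun ω => (Y ω : ℂ) * Complex.I) P := hi1.ofReal.mul_const _
    have h3 : Integrable (fun ω => 1 + (Y ω : ℂ) * Complex.I) P := (integrable_const _).add h1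
    rw [integral_sub h3 h2, integral_add (integrable_const _) h1,
      integral_mul_const, integral_complex_ofReal, hmean, integral_div, hv,
      ← integral_complex_ofReal]
    simp
  have hset : MeasurableSet {ω | δ < |Y ω|} := measurableSet_lt measurable_const hY.abs
  have hind : ∀ ω, (if δ < |Y ω| then Y ω ^ 2 else 0)
      = Set.indicator {ω | δ < |Y ω|} (fun ω => Y ω ^ 2) ω := fun ω => by
    simp [Set.indicator]
  have hA : ‖∫ ω, Complex.exp (Y ω * Complex.I) ∂P - (1 - (v : ℂ) / 2)‖
      ≤ 4 * δ * v + 4 * ∫ ω in {ω | δ < |Y ω|}, Y ω ^ 2 ∂P := by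
    rw [← hT, ← integral_sub hie hiT]
    refine (norm_integral_le_of_norm_le
      (g := fun ω => 4 * δ * Y ω ^ 2
        + 4 * Set.indicator {ω | δ < |Y ω|} (fun ω => Y ω ^ 2) ω) ?_ ?_).trans_eq ?_
    · exact (hi2.const_mul _).add ((hi2.indicator hset).const_mul _)
    · exact ae_of_all _ fun ω => by
        rw [← hind]; exact norm_cexp_mul_I_sub_le hδ hδ1
    · rw [integral_add (hi2.const_mul _) ((hi2.indicator hset).const_mul _),
        integral_const_mul, integral_const_mul, integral_indicator hset]
  have hB : ‖(1 - (v : ℂ) / 2) - Complex.exp (-(v : ℂ) / 2)‖ ≤ v ^ 2 := by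
    rw [norm_sub_rev]
    have h := abs_exp_neg_sub_one_add_le (x := v / 2) (by positivity)
    have : Complex.exp (-(v : ℂ) / 2) - (1 - (v : ℂ) / 2)
        = ((Real.exp (-(v / 2)) - (1 - v / 2) : ℝ) : ℂ) := by
      push_cast; ring_nf
    rw [this, Complex.norm_real, Real.norm_eq_abs]
    nlinarith
  calc _ ≤ _ := norm_sub_le_norm_sub_add_norm_sub _ (1 - (v : ℂ) / 2) _
    _ ≤ _ := add_le_add hA hB

lemma norm_prod_sub_prod_le {ι : Type*} (s : Finset ι) (f g : ι → ℂ)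
    (hf : ∀ i ∈ s, ‖f i‖ ≤ 1) (hg : ∀ i ∈ s, ‖g i‖ ≤ 1) :
    ‖∏ i ∈ s, f i - ∏ i ∈ s, g i‖ ≤ ∑ i ∈ s, ‖f i - g i‖ := by
  classical
  induction s using Finset.induction_on with
  | empty => simp
  | insert a s ha ih =>
    rw [Finset.prod_insert ha, Finset.prod_insert ha, Finset.sum_insert ha]
    have hs := ih (fun i hi => hf i (Finset.mem_insert_of_mem hi))
      (fun i hi => hg i (Finset.mem_insert_of_mem hi))
    have hp : ‖∏ i ∈ s, g i‖ ≤ 1 := by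
      rw [norm_prod]
      exact Finset.prod_le_one (fun _ _ => norm_nonneg _)
        fun i hi => hg i (Finset.mem_insert_of_mem hi)
    have hfa := hf a (Finset.mem_insert_self a s)
    calc _ = ‖(f a - g a) * ∏ i ∈ s, g i + f a * (∏ i ∈ s, f i - ∏ i ∈ s, g i)‖ := by ring_nf
      _ ≤ ‖f a - g a‖ * ‖∏ i ∈ s, g i‖ + ‖f a‖ * ‖∏ i ∈ s, f i - ∏ i ∈ s, g i‖ := by
        rw [← norm_mul, ← norm_mul]; exact norm_add_le _ _
      _ ≤ ‖f a - g a‖ * 1 + 1 * ‖∏ i ∈ s, f i - ∏ i ∈ s, g i‖ := by gcongr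
      _ ≤ _ := by linarith

/-- The quantitative Lindeberg theorem for weighted sums `n ^ (-1 / 2) ∑ j, Re (c j * X j)`. The
bound depends on the weights only through `R`, so that it is uniform over all pairs of eigenvalues.
Since every `X j` has variance `1`, each summand has variance at most `R ^ 2 / n`, and no separate
bound on the largest variance is needed. -/
lemma norm_integral_cexp_sum_sub_le (P : Measure Ω) [IsProbabilityMeasure P]
    {X : ℕ → Ω → ℂ} (hmeas : ∀ j, Measurable (X j)) (hindep : iIndepFun X P)
    (hmean : ∀ j, ∫ ω, X j ω ∂P = 0) (hL2 : ∀ j, MemLp (X j) 2 P)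
    (hvar : ∀ j, ∫ ω, ‖X j ω‖ ^ 2 ∂P = 1)
    {n : ℕ} (hn : 0 < n) {c : ℕ → ℂ} {R : ℝ} (hR : 0 < R) (hc : ∀ j, ‖c j‖ ≤ R)
    {δ : ℝ} (hδ : 0 < δ) (hδ1 : δ ≤ 1) :
    ‖∫ ω, Complex.exp (((∑ j ∈ Finset.range n, (Real.sqrt n)⁻¹ * (c j * X j ω).re : ℝ) : ℂ)
          * Complex.I) ∂P
        - Complex.exp (-(((1 / n : ℝ) * ∑ j ∈ Finset.range n, ∫ ω, (c j * X j ω).re ^ 2 ∂P : ℝ) : ℂ)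
          / 2)‖
      ≤ 4 * δ * R ^ 2 + 4 * R ^ 2 * ((1 / (n : ℝ)) * ∑ j ∈ Finset.range n,
        ∫ ω in {ω | δ / R * Real.sqrt n < ‖X j ω‖}, ‖X j ω‖ ^ 2 ∂P) + R ^ 4 * (1 / n) := by
  have hn' : (0 : ℝ) < n := by exact_mod_cast hn
  have hsn : 0 < Real.sqrt n := Real.sqrt_pos.2 hn'
  have hss : (Real.sqrt n)⁻¹ ^ 2 = 1 / n := by
    rw [inv_pow, Real.sq_sqrt hn'.le, one_div]
  set g : ℕ → ℂ → ℝ := fun j z => (Real.sqrt n)⁻¹ * (c j * z).re with hg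
  have hgm : ∀ j, Measurable (g j) := fun j => by
    have : Continuous (g j) := by fun_prop
    exact this.measurable
  have hYm : ∀ j, Measurable fun ω => g j (X j ω) := fun j => (hgm j).comp (hmeas j)
  have hgle : ∀ j z, |g j z| ≤ (Real.sqrt n)⁻¹ * (R * ‖z‖) := fun j z => by
    rw [hg, abs_mul, abs_of_pos (inv_pos.2 hsn)]
    gcongr
    exact (Complex.abs_re_le_norm _).trans (by rw [norm_mul]; gcongr; exact hc j)
  have hgsq : ∀ j z, g j z ^ 2 ≤ R ^ 2 * (1 / n) * ‖z‖ ^ 2 := fun j z => by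
    rw [← sq_abs, ← hss]
    calc _ ≤ ((Real.sqrt n)⁻¹ * (R * ‖z‖)) ^ 2 := pow_le_pow_left₀ (abs_nonneg _) (hgle j z) 2
      _ = _ := by ring
  have hX2 : ∀ j, Integrable (fun ω => ‖X j ω‖ ^ 2) P := fun j => (hL2 j).norm.integrable_sq
  have hY2 : ∀ j, MemLp (fun ω => g j (X j ω)) 2 P := fun j =>
    MemLp.of_le ((hL2 j).const_mul (((Real.sqrt n)⁻¹ * R : ℝ) : ℂ))
      (hYm j).aestronglyMeasurable (ae_of_all _ fun ω => by
        rw [Complex.norm_mul, Complex.norm_real, Real.norm_eq_abs, Real.norm_eq_abs,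
          abs_of_pos (by positivity : (0 : ℝ) < (Real.sqrt n)⁻¹ * R), mul_assoc]
        exact hgle j _)
  have hYmean : ∀ j, ∫ ω, g j (X j ω) ∂P = 0 := fun j => by
    have hi : Integrable (fun ω => c j * X j ω) P :=
      ((hL2 j).integrable (by norm_num)).const_mul _
    have h := integral_re hi
    simp only [RCLike.re_to_complex] at h
    rw [hg, integral_const_mul, h, integral_const_mul, hmean]
    simp
  have hvle : ∀ j, ∫ ω, g j (X j ω) ^ 2 ∂P ≤ R ^ 2 * (1 / n) := fun j => by
    calc _ ≤ ∫ ω, R ^ 2 * (1 / n) * ‖X j ω‖ ^ 2 ∂P :=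
          integral_mono (hY2 j).integrable_sq ((hX2 j).const_mul _) fun ω => hgsq j _
      _ = _ := by rw [integral_const_mul, hvar, mul_one]
  have hv0 : ∀ j, 0 ≤ ∫ ω, g j (X j ω) ^ 2 ∂P := fun j => integral_nonneg fun _ => sq_nonneg _
  have hprod : ∫ ω, Complex.exp (((∑ j ∈ Finset.range n, g j (X j ω) : ℝ) : ℂ) * Complex.I) ∂P
      = ∏ j ∈ Finset.range n, ∫ ω, Complex.exp (g j (X j ω) * Complex.I) ∂P := by
    have hind : iIndepFun (fun j ω => g j (X j ω)) P := hindep.comp g hgm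
    have := congrFun ((hind.restrict (Finset.range n)).charFun_map_fun_finsetSum_eq_prod
      (fun j _ => (hYm j).aemeasurable)) 1
    rw [Finset.prod_apply] at this
    simp only [charFun_apply_real] at this
    rw [integral_map (by fun_prop) (by fun_prop)] at this
    simp only [Complex.ofReal_one, one_mul] at this
    rw [this]
    refine Finset.prod_congr rfl fun j _ => ?_
    rw [integral_map (hYm j).aemeasurable (by fun_prop)]
  have hexp : Complex.exp (-(((1 / n : ℝ) * ∑ j ∈ Finset.range n,
        ∫ ω, (c j * X j ω).re ^ 2 ∂P : ℝ) : ℂ) / 2)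
      = ∏ j ∈ Finset.range n, Complex.exp (-((∫ ω, g j (X j ω) ^ 2 ∂P : ℝ) : ℂ) / 2) := by
    rw [← Complex.exp_sum, ← Finset.sum_div, Finset.sum_neg_distrib, ← Complex.ofReal_sum,
      Finset.mul_sum]
    simp only [hg, mul_pow, integral_const_mul, hss]
  rw [hprod, hexp]
  have hbd : ∀ j ∈ Finset.range n, ‖∫ ω, Complex.exp (g j (X j ω) * Complex.I) ∂P
        - Complex.exp (-((∫ ω, g j (X j ω) ^ 2 ∂P : ℝ) : ℂ) / 2)‖
      ≤ 4 * δ * (R ^ 2 * (1 / n)) + 4 * (R ^ 2 * (1 / n) *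
        ∫ ω in {ω | δ / R * Real.sqrt n < ‖X j ω‖}, ‖X j ω‖ ^ 2 ∂P) + (R ^ 2 * (1 / n)) ^ 2 := by
    intro j _
    refine (norm_integral_cexp_sub_le P (hYm j) (hYmean j) (hY2 j) hδ hδ1).trans ?_
    refine add_le_add_three ?_ ?_ ?_
    · exact mul_le_mul_of_nonneg_left (hvle j) (by positivity)
    · refine mul_le_mul_of_nonneg_left ?_ (by norm_num)
      rw [← integral_const_mul]
      have hsub : {ω | δ < |g j (X j ω)|} ⊆ {ω | δ / R * Real.sqrt n < ‖X j ω‖} := by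
        intro ω hω
        have h := lt_of_lt_of_le (show δ < _ from hω) (hgle j (X j ω))
        show δ / R * Real.sqrt n < ‖X j ω‖
        rw [div_mul_eq_mul_div, div_lt_iff₀ hR]
        rw [inv_mul_eq_div, lt_div_iff₀ hsn] at h
        linarith
      calc _ ≤ ∫ ω in {ω | δ < |g j (X j ω)|}, R ^ 2 * (1 / n) * ‖X j ω‖ ^ 2 ∂P :=
            integral_mono (hY2 j).integrable_sq.integrableOn
              ((hX2 j).const_mul _).integrableOn fun ω => hgsq j _
        _ ≤ _ := setIntegral_mono_set ((hX2 j).const_mul _).integrableOn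
              (ae_of_all _ fun ω => by positivity) hsub.eventuallyLE
    · exact pow_le_pow_left₀ (hv0 j) (hvle j) 2
  refine (norm_prod_sub_prod_le _ _ _ ?_ ?_).trans ((Finset.sum_le_sum hbd).trans_eq ?_)
  · intro j _
    refine (norm_integral_le_of_norm_le_const (C := 1) (ae_of_all _ fun ω =>
      (Complex.norm_exp_ofReal_mul_I _).le)).trans_eq (by simp)
  · intro j _
    rw [Complex.norm_exp, Real.exp_le_one_iff]
    have := hv0 j
    simp only [Complex.div_ofNat_re, Complex.neg_re, Complex.ofReal_re]
    linarith
  · simp only [Finset.sum_add_distrib, ← Finset.mul_sum, Finset.sum_const, Finset.card_range,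
      nsmul_eq_mul]
    generalize (∑ j ∈ Finset.range n, (_ : ℝ)) = S
    field_simp

/-! ### The spectrum of a circulant matrix -/

/-- The `k`-th power `exp (2πik / n)` of the standard primitive `n`-th root of unity. -/
noncomputable def rootOfUnity (n k : ℕ) : ℂ := Complex.exp (2 * Real.pi * Complex.I / n) ^ k

/-- The eigenvalues `n ^ (-1 / 2) ∑ j, x j * exp (2πijk / n)` of the normalised circulant matrix. -/
noncomputable def eigenvalue (n : ℕ) (x : ℕ → ℂ) (k : ℕ) : ℂ :=
  ∑ j ∈ Finset.range n, ((Real.sqrt n : ℝ) : ℂ)⁻¹ * (rootOfUnity n k ^ j * x j)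

lemma rootOfUnity_pow_self (n k : ℕ) : rootOfUnity n k ^ n = 1 := by
  rcases Nat.eq_zero_or_pos n with rfl | hn
  · simp
  · rw [rootOfUnity, pow_right_comm,
      (Complex.isPrimitiveRoot_exp n hn.ne').pow_eq_one, one_pow]

lemma rootOfUnity_injective (n : ℕ) : Function.Injective fun k : Fin n => rootOfUnity n k := by
  intro k l h
  exact Fin.ext ((Complex.isPrimitiveRoot_exp n k.pos.ne').pow_inj k.2 l.2 h)

/-- The columns of the Fourier matrix are eigenvectors of the circulant matrix. -/
lemma circulantRow_mul_vandermonde (n : ℕ) (x : ℕ → ℂ) :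
    (((Real.sqrt n : ℝ) : ℂ)⁻¹ • circulantRow n x)
        * (Matrix.vandermonde fun k : Fin n => rootOfUnity n k).transpose
      = (Matrix.vandermonde fun k : Fin n => rootOfUnity n k).transpose
        * Matrix.diagonal fun k : Fin n => eigenvalue n x k := by
  ext i k
  have : NeZero n := ⟨i.pos.ne'⟩
  rw [Matrix.mul_diagonal, Matrix.mul_apply]
  simp only [circulantRow, Matrix.smul_apply, Matrix.transpose_apply, Matrix.circulant_apply,
    Matrix.vandermonde_apply, smul_eq_mul, eigenvalue]
  rw [Finset.sum_range, Finset.mul_sum, ← Equiv.sum_comp (Equiv.addRight i)]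
  refine Finset.sum_congr rfl fun j _ => ?_
  -- addition in `Fin n` is modulo `n`, which an `n`-th root of unity does not see
  have hpow : rootOfUnity n k ^ ((j + i : Fin n) : ℕ)
      = rootOfUnity n k ^ (j : ℕ) * rootOfUnity n k ^ (i : ℕ) := by
    rw [Fin.val_add, ← pow_add, ← pow_mod_orderOf, ← pow_mod_orderOf _ ((j : ℕ) + i),
      Nat.mod_mod_of_dvd _ (orderOf_dvd_of_pow_eq_one (rootOfUnity_pow_self n k))]
  simp only [Equiv.coe_addRight, add_sub_cancel_right, hpow]
  ring

lemma charpoly_roots_circulantRow (n : ℕ) (x : ℕ → ℂ) :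
    (((Real.sqrt n : ℝ) : ℂ)⁻¹ • circulantRow n x).charpoly.roots
      = Finset.univ.val.map fun k : Fin n => eigenvalue n x k := by
  have hdet : IsUnit (Matrix.vandermonde fun k : Fin n => rootOfUnity n k).transpose := by
    rw [Matrix.isUnit_iff_isUnit_det, Matrix.det_transpose, isUnit_iff_ne_zero,
      Matrix.det_vandermonde_ne_zero_iff]
    exact rootOfUnity_injective n
  obtain ⟨U, hU⟩ := hdet
  have h := circulantRow_mul_vandermonde n x
  rw [← hU] at h
  have h' : ((Real.sqrt n : ℝ) : ℂ)⁻¹ • circulantRow n x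
      = U.val * (Matrix.diagonal fun k : Fin n => eigenvalue n x k) * U.val⁻¹ := by
    rw [← h, ← Matrix.coe_units_inv, Units.mul_inv_cancel_right]
  rw [h', Matrix.charpoly_units_conj, Matrix.charpoly_diagonal]
  have hroots := Polynomial.roots_multiset_prod_X_sub_C
    (Finset.univ.val.map fun k : Fin n => eigenvalue n x k)
  rwa [Multiset.map_map] at hroots

lemma circulantSpectralMeasure_eq (n : ℕ) (x : ℕ → ℂ) :
    circulantSpectralMeasure n x
      = (n : ℝ≥0∞)⁻¹ • ∑ k : Fin n, Measure.dirac (eigenvalue n x k) := by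
  rw [circulantSpectralMeasure, empiricalSpectralMeasure, charpoly_roots_circulantRow,
    Multiset.map_map]
  rfl

/-! ### Second moments of the eigenvalues -/

lemma sum_pow_eq_zero {n : ℕ} {z : ℂ} (hz : z ^ n = 1) (h1 : z ≠ 1) :
    ∑ j ∈ Finset.range n, z ^ j = 0 := by
  rw [geom_sum_eq h1, hz, sub_self, zero_div]

lemma re_sq_eq (w : ℂ) : w.re ^ 2 = (‖w‖ ^ 2 + (w ^ 2).re) / 2 := by
  rw [Complex.sq_norm, Complex.normSq_apply, pow_two w, Complex.mul_re]
  ring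

lemma integral_re_mul_sq {P : Measure Ω} {X : Ω → ℂ} {α : ℂ}
    (hL2 : MemLp X 2 P) (hsq : ∫ ω, X ω ^ 2 ∂P = α) (hvar : ∫ ω, ‖X ω‖ ^ 2 ∂P = 1) (c : ℂ) :
    ∫ ω, (c * X ω).re ^ 2 ∂P = (‖c‖ ^ 2 + (c ^ 2 * α).re) / 2 := by
  have hi : Integrable (fun ω => ‖X ω‖ ^ 2) P := hL2.norm.integrable_sq
  have hi2 : Integrable (fun ω => X ω ^ 2) P :=
    (integrable_norm_iff (hL2.aestronglyMeasurable.pow 2)).1 (by simpa using hi)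
  have hi3 : Integrable (fun ω => c ^ 2 * X ω ^ 2) P := hi2.const_mul _
  have hi3' : Integrable (fun ω => (c ^ 2 * X ω ^ 2).re) P := hi3.re
  have hre := integral_re hi3
  simp only [RCLike.re_to_complex] at hre
  simp only [re_sq_eq, norm_mul, mul_pow]
  rw [integral_div, integral_add (hi.const_mul _) hi3', integral_const_mul, hvar, mul_one]
  congr 2
  rw [← hsq, ← integral_const_mul]
  exact hre

/-- The pairs of roots of unity whose eigenvalues are exactly uncorrelated, with vanishing
pseudo-covariances: none of the four characters that occur in the second moments is trivial. -/
def Nonresonant (z w : ℂ) : Prop := z ≠ w ∧ z * w ≠ 1 ∧ z ^ 2 ≠ 1 ∧ w ^ 2 ≠ 1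

/-- Orthogonality of the characters of `ℤ / n`: for `n`-th roots of unity `z` and `w` without
resonance, the variance of `n ^ (-1 / 2) ∑ j, Re ((a * z ^ j + b * w ^ j) * X j)` equals that of
`Re (a * Z + b * W)` with independent standard complex Gaussians `Z` and `W`, whatever the
pseudo-variance `α` of the `X j` is. -/
lemma sum_variance_eq {n : ℕ} (hn : 0 < n) {z w : ℂ} (hz : z ^ n = 1) (hw : w ^ n = 1)
    (h : Nonresonant z w) (a b α : ℂ) :
    (1 / n : ℝ) * ∑ j ∈ Finset.range n,
        (‖a * z ^ j + b * w ^ j‖ ^ 2 + ((a * z ^ j + b * w ^ j) ^ 2 * α).re) / 2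
      = (‖a‖ ^ 2 + ‖b‖ ^ 2) / 2 := by
  obtain ⟨hzw, hzw1, hz2, hw2⟩ := h
  have hn' : (n : ℝ) ≠ 0 := by positivity
  have hnz : ‖z‖ = 1 := Complex.norm_eq_one_of_pow_eq_one hz hn.ne'
  have hnw : ‖w‖ = 1 := Complex.norm_eq_one_of_pow_eq_one hw hn.ne'
  have hcw : conj w * w = 1 := by rw [Complex.conj_mul', hnw]; simp
  have hA : ∑ j ∈ Finset.range n, ‖a * z ^ j + b * w ^ j‖ ^ 2 = n * (‖a‖ ^ 2 + ‖b‖ ^ 2) := by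
    have hq : ∑ j ∈ Finset.range n, (z * conj w) ^ j = 0 := by
      refine sum_pow_eq_zero ?_ ?_
      · rw [mul_pow, hz, ← map_pow, hw, map_one, one_mul]
      · intro h
        refine hzw ?_
        calc z = z * (conj w * w) := by rw [hcw, mul_one]
          _ = w := by rw [← mul_assoc, h, one_mul]
    have : ∀ j, ‖a * z ^ j + b * w ^ j‖ ^ 2
        = (‖a‖ ^ 2 + ‖b‖ ^ 2) + 2 * (a * conj b * (z * conj w) ^ j).re := fun j => by
      rw [Complex.sq_norm, Complex.normSq_add, Complex.normSq_eq_norm_sq, Complex.normSq_eq_norm_sq,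
        norm_mul, norm_mul, norm_pow, norm_pow, hnz, hnw, map_mul, map_pow, mul_pow]
      simp only [one_pow, mul_one]
      ring_nf
    simp only [this]
    rw [Finset.sum_add_distrib, ← Finset.mul_sum, ← Complex.re_sum, ← Finset.mul_sum, hq]
    simp [mul_add]
  have hB : ∑ j ∈ Finset.range n, (a * z ^ j + b * w ^ j) ^ 2 = 0 := by
    have h1 := sum_pow_eq_zero (n := n) (z := z ^ 2) (by rw [← pow_mul, mul_comm, pow_mul, hz,
      one_pow]) hz2
    have h2 := sum_pow_eq_zero (n := n) (z := w ^ 2) (by rw [← pow_mul, mul_comm, pow_mul, hw,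
      one_pow]) hw2
    have h3 := sum_pow_eq_zero (n := n) (z := z * w) (by rw [mul_pow, hz, hw, one_mul]) hzw1
    have : ∀ j : ℕ, (a * z ^ j + b * w ^ j) ^ 2
        = a ^ 2 * (z ^ 2) ^ j + b ^ 2 * (w ^ 2) ^ j + 2 * a * b * (z * w) ^ j := fun j => by
      rw [← pow_mul, ← pow_mul, mul_pow]; ring
    simp only [this]
    rw [Finset.sum_add_distrib, Finset.sum_add_distrib, ← Finset.mul_sum, ← Finset.mul_sum,
      ← Finset.mul_sum, h1, h2, h3]
    simp
  rw [← Finset.sum_div, Finset.sum_add_distrib, hA, ← Complex.re_sum, ← Finset.sum_mul, hB]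
  field_simp
  simp

open scoped Classical in
/-- Only `O(n)` of the `n ^ 2` pairs are resonant: at most four partners for each `k`, and at most
two values of `k` with `rootOfUnity n k = ± 1`. -/
lemma card_not_nonresonant_le (n : ℕ) :
    (Finset.univ.filter fun p : Fin n × Fin n =>
      ¬ Nonresonant (rootOfUnity n p.1) (rootOfUnity n p.2)).card ≤ 6 * n := by
  have hpre : ∀ s : Finset ℂ, (Finset.univ.filter fun k : Fin n => rootOfUnity n k ∈ s).card
      ≤ s.card := fun s =>
    Finset.card_le_card_of_injOn (fun k : Fin n => rootOfUnity n k) (by intro k; simp)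
      (rootOfUnity_injective n).injOn
  have hsub : (Finset.univ.filter fun p : Fin n × Fin n =>
      ¬ Nonresonant (rootOfUnity n p.1) (rootOfUnity n p.2))
      ⊆ (Finset.univ.biUnion fun k : Fin n => (Finset.univ.filter fun l : Fin n =>
          rootOfUnity n l ∈ ({rootOfUnity n k, (rootOfUnity n k)⁻¹, 1, -1} : Finset ℂ)).image
            fun l => (k, l))
        ∪ (Finset.univ.filter fun k : Fin n => rootOfUnity n k ∈ ({1, -1} : Finset ℂ)) ×ˢ
            Finset.univ := by
    rintro ⟨k, l⟩ h
    simp only [Finset.mem_filter, Finset.mem_univ, true_and, Nonresonant, not_and_or, not_not,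
      Finset.mem_union, Finset.mem_biUnion, Finset.mem_image, Finset.mem_insert,
      Finset.mem_singleton, Finset.mem_product, and_true, Prod.mk.injEq] at h ⊢
    rcases h with h | h | h | h
    · exact Or.inl ⟨k, l, Or.inl h.symm, rfl, rfl⟩
    · exact Or.inl ⟨k, l, Or.inr (Or.inl (eq_inv_of_mul_eq_one_right h)), rfl, rfl⟩
    · exact Or.inr (sq_eq_one_iff.1 h)
    · exact Or.inl ⟨k, l, Or.inr (Or.inr (sq_eq_one_iff.1 h)), rfl, rfl⟩
  refine (Finset.card_le_card hsub).trans ((Finset.card_union_le _ _).trans ?_)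
  have h1 : (Finset.univ.biUnion fun k : Fin n => (Finset.univ.filter fun l : Fin n =>
          rootOfUnity n l ∈ ({rootOfUnity n k, (rootOfUnity n k)⁻¹, 1, -1} : Finset ℂ)).image
            fun l => (k, l)).card ≤ n * 4 := by
    refine Finset.card_biUnion_le.trans ((Finset.sum_le_card_nsmul _ _ 4 fun k _ => ?_).trans ?_)
    · exact Finset.card_image_le.trans ((hpre _).trans Finset.card_le_four)
    · simp
  have h2 : ((Finset.univ.filter fun k : Fin n => rootOfUnity n k ∈ ({1, -1} : Finset ℂ)) ×ˢ
            (Finset.univ : Finset (Fin n))).card ≤ 2 * n := by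
    rw [Finset.card_product, Finset.card_univ, Fintype.card_fin]
    exact Nat.mul_le_mul_right _ ((hpre _).trans Finset.card_le_two)
  omega

/-! ### Gaussian limit and Lévy's theorem -/

instance isProbabilityMeasure_complexGaussian : IsProbabilityMeasure complexGaussian := by
  constructor
  have hint : Integrable (fun z : ℂ => Real.exp (-‖z‖ ^ 2)) := by
    have h := (GaussianFourier.integrable_cexp_neg_mul_sq_norm_add (b := 1) (V := ℂ)
      (by simp) 0 0).norm
    refine h.congr (ae_of_all _ fun z => ?_)
    simp only [Complex.norm_exp]
    norm_cast
    simp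
  have h := GaussianFourier.integral_rexp_neg_mul_sq_norm (V := ℂ) one_pos
  rw [complexGaussian, withDensity_apply _ MeasurableSet.univ, Measure.restrict_univ,
    ← ofReal_integral_eq_lintegral_ofReal (hint.const_mul _)
      (ae_of_all _ fun z => by positivity), integral_const_mul]
  simp only [neg_mul, one_mul, Complex.finrank_real_complex, div_one] at h
  rw [h]
  simp [Real.pi_pos.ne']

lemma integral_cexp_inner_complexGaussian (t : ℂ) :
    ∫ z, Complex.exp ((inner ℝ z t : ℝ) * Complex.I) ∂complexGaussian
      = Complex.exp (-(‖t‖ ^ 2 / 4 : ℝ)) := by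
  have h := GaussianFourier.integral_cexp_neg_mul_sq_norm_add (b := 1) (V := ℂ)
      (by simp) Complex.I t
  rw [complexGaussian, integral_withDensity_eq_integral_toReal_smul (by fun_prop)
    (ae_of_all _ fun z => ENNReal.ofReal_lt_top)]
  have : ∀ z : ℂ, (ENNReal.ofReal (Real.pi⁻¹ * Real.exp (-‖z‖ ^ 2))).toReal •
      Complex.exp ((inner ℝ z t : ℝ) * Complex.I)
      = (Real.pi : ℂ)⁻¹ * Complex.exp (-1 * ‖z‖ ^ 2 + Complex.I * (inner ℝ t z : ℝ)) := fun z => by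
    rw [ENNReal.toReal_ofReal (by positivity), Complex.exp_add, real_inner_comm, Complex.real_smul]
    push_cast
    ring_nf
  simp only [this]
  rw [integral_const_mul, h]
  simp [Real.pi_ne_zero]
  ring_nf

/-- Lévy's continuity theorem on `ℂ × ℂ`. The product carries the sup norm, so the theorem is
applied on the Hilbert space `WithLp 2 (ℂ × ℂ)` and transported back. -/
lemma tendsto_of_forall_integral_cexp {μ : ℕ → ProbabilityMeasure (ℂ × ℂ)}
    {μ₀ : ProbabilityMeasure (ℂ × ℂ)}
    (h : ∀ s t : ℂ, Tendsto
      (fun n => ∫ p, Complex.exp ((inner ℝ p.1 s + inner ℝ p.2 t : ℝ) * Complex.I)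
        ∂(μ n : Measure (ℂ × ℂ))) atTop
      (𝓝 (∫ p, Complex.exp ((inner ℝ p.1 s + inner ℝ p.2 t : ℝ) * Complex.I)
        ∂(μ₀ : Measure (ℂ × ℂ))))) :
    Tendsto μ atTop (𝓝 μ₀) := by
  have hm : ∀ ν : ProbabilityMeasure (ℂ × ℂ), AEMeasurable (WithLp.toLp 2) (ν : Measure (ℂ × ℂ)) :=
    fun ν => (WithLp.measurable_toLp 2 (ℂ × ℂ)).aemeasurable
  have hc : ∀ (ν : ProbabilityMeasure (ℂ × ℂ)) (t : WithLp 2 (ℂ × ℂ)),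
      charFun (ν.map (hm ν) : Measure (WithLp 2 (ℂ × ℂ))) t
        = ∫ p, Complex.exp ((inner ℝ p.1 t.ofLp.1 + inner ℝ p.2 t.ofLp.2 : ℝ) * Complex.I)
          ∂(ν : Measure (ℂ × ℂ)) := fun ν t => by
    rw [charFun_apply, ProbabilityMeasure.toMeasure_map, integral_map (hm ν) (by fun_prop)]
    simp only [WithLp.prod_inner_apply]
  have hT : Tendsto (fun n => (μ n).map (hm (μ n))) atTop (𝓝 (μ₀.map (hm μ₀))) :=
    ProbabilityMeasure.tendsto_of_tendsto_charFun fun t => by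
      simp only [hc]
      exact h _ _
  have hf : Continuous (WithLp.ofLp : WithLp 2 (ℂ × ℂ) → ℂ × ℂ) := by fun_prop
  have hback : ∀ ν : ProbabilityMeasure (ℂ × ℂ), (ν.map (hm ν)).map hf.aemeasurable = ν :=
    fun ν => Subtype.ext
      ((Measure.map_map hf.measurable (WithLp.measurable_toLp 2 (ℂ × ℂ))).trans Measure.map_id)
  have := ProbabilityMeasure.tendsto_map_of_tendsto_of_continuous _ _ hT hf
  simpa only [hback] using this

/-! ### Convergence in probability -/

/-- Chebyshev's inequality: uniformly bounded random variables whose first two moments converge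
to those of a constant converge to that constant in probability. -/
lemma tendstoInMeasure_const_of_tendsto_integral {P : Measure Ω} [IsProbabilityMeasure P]
    {S : ℕ → Ω → ℝ} {C m : ℝ} (hSm : ∀ n, Measurable (S n)) (hSb : ∀ n ω, ‖S n ω‖ ≤ C)
    (h1 : Tendsto (fun n => ∫ ω, S n ω ∂P) atTop (𝓝 m))
    (h2 : Tendsto (fun n => ∫ ω, S n ω * S n ω ∂P) atTop (𝓝 (m * m))) :
    TendstoInMeasure P S atTop fun _ => m := by
  have hi1 : ∀ n, Integrable (S n) P := fun n =>
    Integrable.of_bound (hSm n).aestronglyMeasurable C (ae_of_all _ (hSb n))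
  have hi2 : ∀ n, Integrable (fun ω => S n ω * S n ω) P := fun n =>
    (hi1 n).mul_bdd (hSm n).aestronglyMeasurable (ae_of_all _ (hSb n))
  have hi3 : ∀ n, Integrable (fun ω => S n ω * S n ω - 2 * m * S n ω) P := fun n =>
    (hi2 n).sub ((hi1 n).const_mul _)
  have hexpand : ∀ n ω, (S n ω - m) ^ 2 = S n ω * S n ω - 2 * m * S n ω + m ^ 2 :=
    fun n ω => by ring
  have hi : ∀ n, Integrable (fun ω => (S n ω - m) ^ 2) P := fun n => by
    simp only [hexpand]
    exact (hi3 n).add (integrable_const _)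
  have hlim : Tendsto (fun n => ∫ ω, (S n ω - m) ^ 2 ∂P) atTop (𝓝 0) := by
    have h := (h2.sub (h1.const_mul (2 * m))).add_const (m ^ 2)
    have h0 : m * m - 2 * m * m + m ^ 2 = 0 := by ring
    rw [h0] at h
    refine h.congr fun n => ?_
    simp only [hexpand]
    rw [integral_add (hi3 n) (integrable_const _), integral_sub (hi2 n) ((hi1 n).const_mul _),
      integral_const_mul]
    simp
  rw [tendstoInMeasure_iff_measureReal_norm]
  intro ε hε
  refine squeeze_zero (fun n => measureReal_nonneg) (fun n => ?_)
    (by simpa using hlim.const_mul (ε ^ 2)⁻¹)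
  have hset : {ω | ε ≤ ‖S n ω - m‖} = {ω | ε ^ 2 ≤ (S n ω - m) ^ 2} := by
    ext ω
    simp only [Set.mem_ofPred_eq, Real.norm_eq_abs]
    rw [← sq_abs (S n ω - m), pow_le_pow_iff_left₀ hε.le (abs_nonneg _) two_ne_zero]
  rw [le_inv_mul_iff₀ (by positivity), hset]
  exact mul_meas_ge_le_integral_of_nonneg (ae_of_all P fun ω => sq_nonneg (S n ω - m)) (hi n) _

/-! ### The law of a random pair of eigenvalues -/

lemma measurable_eigenvalue {X : ℕ → Ω → ℂ} (hmeas : ∀ j, Measurable (X j)) (n k : ℕ) :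
    Measurable fun ω => eigenvalue n (fun j => X j ω) k := by
  unfold eigenvalue
  fun_prop

lemma measurable_circulantSpectralMeasure {X : ℕ → Ω → ℂ} (hmeas : ∀ j, Measurable (X j))
    (n : ℕ) : Measurable fun ω => circulantSpectralMeasure n (fun j => X j ω) := by
  simp only [circulantSpectralMeasure_eq]
  refine Measure.measurable_of_measurable_coe _ fun s hs => ?_
  simp only [Measure.smul_apply, Measure.finsetSum_apply, smul_eq_mul]
  refine Measurable.const_mul (Finset.measurable_fun_sum _ fun k _ => ?_) _
  exact (Measure.measurable_coe hs).comp
    (Measure.measurable_dirac.comp (measurable_eigenvalue hmeas n k))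

/-- The expectation of `μ_n ⊗ μ_n`, where `μ_n` is the spectral measure: the law of a pair of
eigenvalues whose indices are chosen independently and uniformly. -/
noncomputable def pairLaw (P : Measure Ω) (X : ℕ → Ω → ℂ) (n : ℕ) : Measure (ℂ × ℂ) :=
  ((n : ℝ≥0∞)⁻¹ * (n : ℝ≥0∞)⁻¹) • ∑ p : Fin n × Fin n, P.map fun ω =>
    (eigenvalue n (fun j => X j ω) p.1, eigenvalue n (fun j => X j ω) p.2)

lemma measurable_eigenvalue_pair {X : ℕ → Ω → ℂ} (hmeas : ∀ j, Measurable (X j)) (n k l : ℕ) :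
    Measurable fun ω => (eigenvalue n (fun j => X j ω) k, eigenvalue n (fun j => X j ω) l) :=
  (measurable_eigenvalue hmeas n k).prodMk (measurable_eigenvalue hmeas n l)

lemma isProbabilityMeasure_pairLaw (P : Measure Ω) [IsProbabilityMeasure P] {X : ℕ → Ω → ℂ}
    (hmeas : ∀ j, Measurable (X j)) {n : ℕ} (hn : n ≠ 0) :
    IsProbabilityMeasure (pairLaw P X n) := by
  constructor
  rw [pairLaw, Measure.smul_apply, Measure.finsetSum_apply]
  have : ∀ p : Fin n × Fin n, (P.map fun ω => (eigenvalue n (fun j => X j ω) p.1,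
      eigenvalue n (fun j => X j ω) p.2)) Set.univ = 1 := fun p => by
    rw [Measure.map_apply (measurable_eigenvalue_pair hmeas n _ _) MeasurableSet.univ]
    simp
  simp only [this, Finset.sum_const, Finset.card_univ, Fintype.card_prod, Fintype.card_fin,
    smul_eq_mul, nsmul_eq_mul, mul_one, Nat.cast_mul]
  rw [mul_mul_mul_comm, ENNReal.inv_mul_cancel (by simpa using hn) (by simp), one_mul]

lemma integral_pairLaw {E : Type*} [NormedAddCommGroup E] [NormedSpace ℝ E]
    [SecondCountableTopology E] [MeasurableSpace E] [BorelSpace E] (P : Measure Ω)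
    [IsProbabilityMeasure P] {X : ℕ → Ω → ℂ} (hmeas : ∀ j, Measurable (X j)) (n : ℕ)
    (F : (ℂ × ℂ) →ᵇ E) :
    ∫ p, F p ∂pairLaw P X n = ((n : ℝ)⁻¹ * (n : ℝ)⁻¹) • ∑ p : Fin n × Fin n,
      ∫ ω, F (eigenvalue n (fun j => X j ω) p.1, eigenvalue n (fun j => X j ω) p.2) ∂P := by
  rw [pairLaw, integral_smul_measure, integral_finsetSum_measure]
  · congr 1
    · simp
    · refine Finset.sum_congr rfl fun p _ => ?_
      rw [integral_map (measurable_eigenvalue_pair hmeas n _ _).aemeasurable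
        F.continuous.aestronglyMeasurable]
  · intro p _
    have := Measure.isProbabilityMeasure_map (μ := P)
      (measurable_eigenvalue_pair hmeas n p.1 p.2).aemeasurable
    exact F.integrable _

/-- A real linear functional of two eigenvalues is a weighted sum of the entries, of the form
treated by Lindeberg's theorem. -/
lemma inner_eigenvalue_add (n : ℕ) (x : ℕ → ℂ) (k l : ℕ) (s t : ℂ) :
    (inner ℝ (eigenvalue n x k) s + inner ℝ (eigenvalue n x l) t : ℝ)
      = ∑ j ∈ Finset.range n, (Real.sqrt n)⁻¹ *
        ((conj s * rootOfUnity n k ^ j + conj t * rootOfUnity n l ^ j) * x j).re := by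
  rw [real_inner_comm, real_inner_comm t, Complex.inner, Complex.inner, ← Complex.add_re,
    eigenvalue, eigenvalue, Finset.sum_mul, Finset.sum_mul, ← Finset.sum_add_distrib,
    Complex.re_sum]
  refine Finset.sum_congr rfl fun j _ => ?_
  rw [← Complex.re_ofReal_mul]
  push_cast
  ring_nf

/-- The Bochner integral of a non-integrable function is `0`, so a second moment equal to `1` entails
square integrability. -/
lemma memLp_two_of_integral_sq_norm_eq_one {P : Measure Ω} {X : Ω → ℂ} (hX : Measurable X)
    (hvar : ∫ ω, ‖X ω‖ ^ 2 ∂P = 1) : MemLp X 2 P := by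
  rw [memLp_two_iff_integrable_sq_norm hX.aestronglyMeasurable]
  by_contra h
  rw [integral_undef h] at hvar
  exact zero_ne_one hvar

/-- The characteristic function of the pair law converges to that of two independent standard
complex Gaussians: nonresonant pairs obey a uniform Lindeberg bound, resonant ones are negligible
in number. -/
lemma tendsto_integral_cexp_pairLaw (P : Measure Ω) [IsProbabilityMeasure P]
    {X : ℕ → Ω → ℂ} (hmeas : ∀ j, Measurable (X j)) (hindep : iIndepFun X P)
    {α : ℂ} (hmean : ∀ j, ∫ ω, X j ω ∂P = 0) (hsq : ∀ j, ∫ ω, X j ω ^ 2 ∂P = α)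
    (hvar : ∀ j, ∫ ω, ‖X j ω‖ ^ 2 ∂P = 1)
    (hLindeberg : ∀ ε : ℝ, 0 < ε →
      Tendsto (fun n : ℕ => (1 / (n : ℝ)) * ∑ j ∈ Finset.range n,
        ∫ ω in {ω | ε * Real.sqrt n < ‖X j ω‖}, ‖X j ω‖ ^ 2 ∂P) atTop (𝓝 0)) (s t : ℂ) :
    Tendsto (fun n => ∫ p, Complex.exp ((inner ℝ p.1 s + inner ℝ p.2 t : ℝ) * Complex.I)
        ∂pairLaw P X n) atTop (𝓝 (Complex.exp (-((‖s‖ ^ 2 + ‖t‖ ^ 2) / 4 : ℝ)))) := by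
  classical
  have hL2 j := memLp_two_of_integral_sq_norm_eq_one (hmeas j) (hvar j)
  set G : ℂ := Complex.exp (-((‖s‖ ^ 2 + ‖t‖ ^ 2) / 4 : ℝ)) with hG
  have hG1 : ‖G‖ ≤ 1 := by
    rw [hG, ← Complex.ofReal_neg, Complex.norm_exp_ofReal, Real.exp_le_one_iff]
    have : 0 ≤ (‖s‖ ^ 2 + ‖t‖ ^ 2) / 4 := by positivity
    linarith
  set R : ℝ := ‖s‖ + ‖t‖ + 1 with hRdef
  have hR : 0 < R := by positivity
  let F : (ℂ × ℂ) →ᵇ ℂ := BoundedContinuousFunction.ofNormedAddCommGroup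
    (fun p => Complex.exp ((inner ℝ p.1 s + inner ℝ p.2 t : ℝ) * Complex.I)) (by fun_prop) 1
    fun p => (Complex.norm_exp_ofReal_mul_I _).le
  let φ : (n : ℕ) → Fin n × Fin n → ℂ := fun n p =>
    ∫ ω, F (eigenvalue n (fun j => X j ω) p.1, eigenvalue n (fun j => X j ω) p.2) ∂P
  have hφ1 : ∀ n p, ‖φ n p‖ ≤ 1 := fun n p =>
    (norm_integral_le_of_norm_le_const (C := 1) (ae_of_all _ fun ω =>
      (Complex.norm_exp_ofReal_mul_I _).le)).trans_eq (by simp)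
  let B : ℝ → ℕ → ℝ := fun δ n => 4 * δ * R ^ 2 + 4 * R ^ 2 * ((1 / (n : ℝ)) *
    ∑ j ∈ Finset.range n,
        ∫ ω in {ω | δ / R * Real.sqrt n < ‖X j ω‖}, ‖X j ω‖ ^ 2 ∂P) + R ^ 4 * (1 / n)
  have hgood : ∀ δ : ℝ, 0 < δ → δ ≤ 1 → ∀ n (p : Fin n × Fin n),
      Nonresonant (rootOfUnity n p.1) (rootOfUnity n p.2) → ‖φ n p - G‖ ≤ B δ n := by
    rintro δ hδ hδ1 n ⟨k, l⟩ hkl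
    have hn : 0 < n := k.pos
    have hroot : ∀ m, ‖rootOfUnity n m‖ = 1 := fun m =>
      Complex.norm_eq_one_of_pow_eq_one (rootOfUnity_pow_self n m) hn.ne'
    have h := norm_integral_cexp_sum_sub_le P hmeas hindep hmean hL2 hvar hn
      (c := fun j => conj s * rootOfUnity n k ^ j + conj t * rootOfUnity n l ^ j) hR
      (fun j => (norm_add_le _ _).trans (by simp [hroot, hRdef])) hδ hδ1
    have hV := sum_variance_eq hn (rootOfUnity_pow_self n k) (rootOfUnity_pow_self n l)
      hkl (conj s) (conj t) α
    simp only [fun j => integral_re_mul_sq (hL2 j) (hsq j) (hvar j), hV] at h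
    have hGe : Complex.exp (-(((‖conj s‖ ^ 2 + ‖conj t‖ ^ 2) / 2 : ℝ) : ℂ) / 2) = G := by
      rw [hG, RCLike.norm_conj, RCLike.norm_conj]
      push_cast
      ring_nf
    rw [hGe] at h
    simp only [← inner_eigenvalue_add] at h
    exact h
  have hB0 : ∀ δ, 0 < δ → ∀ n, 0 ≤ B δ n := fun δ hδ n => by
    have : 0 ≤ ∑ j ∈ Finset.range n,
        ∫ ω in {ω | δ / R * Real.sqrt n < ‖X j ω‖}, ‖X j ω‖ ^ 2 ∂P :=
      Finset.sum_nonneg fun j _ => integral_nonneg fun ω => by positivity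
    positivity
  -- `12 / n` is the contribution of at most `6 * n` resonant pairs, each costing at most `2`
  have hmain : ∀ δ : ℝ, 0 < δ → δ ≤ 1 → ∀ n : ℕ, 0 < n →
      ‖∫ p, F p ∂pairLaw P X n - G‖ ≤ B δ n + 12 * (1 / n) := by
    intro δ hδ hδ1 n hn
    have hn' : (0 : ℝ) < n := by exact_mod_cast hn
    have hsum : ∑ p, ‖φ n p - G‖ ≤ n * n * B δ n + 12 * n := by
      calc _ ≤ ∑ p : Fin n × Fin n, (B δ n + if ¬ Nonresonant (rootOfUnity n p.1) (rootOfUnity n p.2)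
              then 2 else 0) := by
            refine Finset.sum_le_sum fun p _ => ?_
            by_cases hp : Nonresonant (rootOfUnity n p.1) (rootOfUnity n p.2)
            · simpa [hp] using hgood δ hδ hδ1 n p hp
            · rw [if_pos hp]
              have := (norm_sub_le (φ n p) G).trans (add_le_add (hφ1 n p) hG1)
              linarith [hB0 δ hδ n]
        _ = n * n * B δ n + (Finset.univ.filter fun p : Fin n × Fin n =>
              ¬ Nonresonant (rootOfUnity n p.1) (rootOfUnity n p.2)).card * 2 := by
            rw [Finset.sum_add_distrib, ← Finset.sum_filter]
            simp
        _ ≤ _ := by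
            have : ((Finset.univ.filter fun p : Fin n × Fin n =>
              ¬ Nonresonant (rootOfUnity n p.1) (rootOfUnity n p.2)).card : ℝ) ≤ 6 * n := by
              exact_mod_cast card_not_nonresonant_le n
            linarith
    have heq : ∫ p, F p ∂pairLaw P X n - G
        = ((n : ℝ)⁻¹ * (n : ℝ)⁻¹) • ∑ p, (φ n p - G) := by
      rw [integral_pairLaw P hmeas n F, Finset.sum_sub_distrib, smul_sub]
      congr 1
      simp only [Finset.sum_const, Finset.card_univ, Fintype.card_prod, Fintype.card_fin]
      have : (n : ℂ) ≠ 0 := by exact_mod_cast hn.ne'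
      simp [Complex.real_smul]
      field_simp
    rw [heq, norm_smul, Real.norm_of_nonneg (by positivity)]
    calc _ ≤ ((n : ℝ)⁻¹ * (n : ℝ)⁻¹) * (n * n * B δ n + 12 * n) := by
          gcongr
          exact (norm_sum_le _ _).trans hsum
      _ = _ := by field_simp
  rw [Metric.tendsto_atTop']
  intro ε hε
  set δ : ℝ := min 1 (ε / (8 * R ^ 2)) with hδdef
  have hδ : 0 < δ := lt_min one_pos (by positivity)
  have hδε : 4 * δ * R ^ 2 ≤ ε / 2 := by
    calc 4 * δ * R ^ 2 ≤ 4 * (ε / (8 * R ^ 2)) * R ^ 2 := by gcongr; exact min_le_right _ _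
      _ = ε / 2 := by field_simp; norm_num
  have hlim : Tendsto (fun n : ℕ => 4 * R ^ 2 * ((1 / (n : ℝ)) * ∑ j ∈ Finset.range n,
        ∫ ω in {ω | δ / R * Real.sqrt n < ‖X j ω‖}, ‖X j ω‖ ^ 2 ∂P) + R ^ 4 * (1 / n)
        + 12 * (1 / n)) atTop (𝓝 0) := by
    have h1 := (hLindeberg (δ / R) (by positivity)).const_mul (4 * R ^ 2)
    have h2 := tendsto_one_div_atTop_nhds_zero_nat (𝕜 := ℝ)
    simpa using (h1.add (h2.const_mul (R ^ 4))).add (h2.const_mul 12)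
  obtain ⟨N, hN⟩ := eventually_atTop.1 (hlim.eventually_lt_const (half_pos hε))
  refine ⟨N, fun n hn => ?_⟩
  rw [dist_eq_norm]
  refine (hmain δ hδ (min_le_left _ _) n (by omega)).trans_lt ?_
  have := hN n hn.le
  simp only [B]
  linarith

/-! ### Moments of the spectral measure -/

lemma integral_circulantSpectralMeasure (n : ℕ) (x : ℕ → ℂ) (f : ℂ →ᵇ ℝ) :
    ∫ z, f z ∂circulantSpectralMeasure n x = (n : ℝ)⁻¹ * ∑ k : Fin n, f (eigenvalue n x k) := by
  rw [circulantSpectralMeasure_eq, integral_smul_measure, integral_finsetSum_measure]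
  · simp
  · intro k _
    exact f.integrable _

lemma isProbabilityMeasure_circulantSpectralMeasure {n : ℕ} (hn : n ≠ 0) (x : ℕ → ℂ) :
    IsProbabilityMeasure (circulantSpectralMeasure n x) := by
  constructor
  rw [circulantSpectralMeasure_eq, Measure.smul_apply, Measure.finsetSum_apply]
  simp [ENNReal.inv_mul_cancel, hn]

lemma integral_mul_integral_circulantSpectralMeasure (P : Measure Ω) [IsProbabilityMeasure P]
    {X : ℕ → Ω → ℂ} (hmeas : ∀ j, Measurable (X j)) (n : ℕ) (f g : ℂ →ᵇ ℝ) :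
    ∫ ω, (∫ z, f z ∂circulantSpectralMeasure n (fun j => X j ω)) *
        ∫ z, g z ∂circulantSpectralMeasure n (fun j => X j ω) ∂P
      = ∫ p, f p.1 * g p.2 ∂pairLaw P X n := by
  let F : (ℂ × ℂ) →ᵇ ℝ := f.compContinuous ⟨Prod.fst, continuous_fst⟩
    * g.compContinuous ⟨Prod.snd, continuous_snd⟩
  have hF := integral_pairLaw P hmeas n F
  have : ∀ p, F p = f p.1 * g p.2 := fun p => rfl
  simp only [this] at hF
  rw [hF]
  simp only [integral_circulantSpectralMeasure]
  rw [← integral_finsetSum, smul_eq_mul, ← integral_const_mul]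
  · refine integral_congr_ae (ae_of_all _ fun ω => ?_)
    simp only [Fintype.sum_prod_type, ← Finset.mul_sum, ← Finset.sum_mul]
    ring
  · intro p _
    have := Measure.isProbabilityMeasure_map (μ := P)
      (measurable_eigenvalue_pair hmeas n p.1 p.2).aemeasurable
    exact (F.integrable (P.map _)).comp_measurable (measurable_eigenvalue_pair hmeas n p.1 p.2)

lemma lintegral_mul_circulantSpectralMeasure (P : Measure Ω)
    {X : ℕ → Ω → ℂ} (hmeas : ∀ j, Measurable (X j)) (n : ℕ) {A B : Set ℂ}
    (hA : MeasurableSet A) (hB : MeasurableSet B) :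
    ∫⁻ ω, circulantSpectralMeasure n (fun j => X j ω) A *
        circulantSpectralMeasure n (fun j => X j ω) B ∂P
      = pairLaw P X n (A ×ˢ B) := by
  rw [pairLaw, Measure.smul_apply, Measure.finsetSum_apply, smul_eq_mul]
  have hp : ∀ p : Fin n × Fin n, (P.map fun ω => (eigenvalue n (fun j => X j ω) p.1,
      eigenvalue n (fun j => X j ω) p.2)) (A ×ˢ B)
      = ∫⁻ ω, A.indicator 1 (eigenvalue n (fun j => X j ω) p.1) *
          B.indicator 1 (eigenvalue n (fun j => X j ω) p.2) ∂P := fun p => by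
    rw [← lintegral_indicator_one (hA.prod hB), lintegral_map
      (measurable_one.indicator (hA.prod hB)) (measurable_eigenvalue_pair hmeas n _ _)]
    refine lintegral_congr fun ω => ?_
    exact Set.indicator_prod_one
  have hm : ∀ (C : Set ℂ), MeasurableSet C → ∀ k : ℕ, Measurable fun ω =>
      C.indicator (1 : ℂ → ℝ≥0∞) (eigenvalue n (fun j => X j ω) k) := fun C hC k =>
    (measurable_one.indicator hC).comp (measurable_eigenvalue hmeas n k)
  simp only [hp]
  have hmm : ∀ p : Fin n × Fin n, Measurable fun ω =>
      A.indicator (1 : ℂ → ℝ≥0∞) (eigenvalue n (fun j => X j ω) p.1) *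
        B.indicator (1 : ℂ → ℝ≥0∞) (eigenvalue n (fun j => X j ω) p.2) := fun p =>
    (hm A hA _).mul (hm B hB _)
  rw [← lintegral_finsetSum _ fun p _ => hmm p, ← lintegral_const_mul _
    (Finset.measurable_fun_sum _ fun p _ => hmm p)]
  refine lintegral_congr fun ω => ?_
  simp only [circulantSpectralMeasure_eq, Measure.smul_apply, Measure.finsetSum_apply, smul_eq_mul,
    Measure.dirac_apply' _ hA, Measure.dirac_apply' _ hB, Fintype.sum_prod_type, ← Finset.mul_sum,
    ← Finset.sum_mul]
  ring

/-- The boundary of a convex set is Lebesgue null, and `γ ⊗ γ` has a density. -/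
lemma complexGaussian_prod_frontier {s : Set (ℂ × ℂ)} (hs : Convex ℝ s) :
    (complexGaussian.prod complexGaussian) (frontier s) = 0 := by
  have hac : complexGaussian ≪ volume := withDensity_absolutelyContinuous _ _
  exact hac.prod hac (hs.addHaar_frontier _)

end RandomCirculant

/-! ### The Gaussian limit for random circulant matrices -/

open RandomCirculant in
theorem theorem1 {Ω : Type*} [MeasurableSpace Ω] (P : Measure Ω) [IsProbabilityMeasure P]
    (X : ℕ → Ω → ℂ) (hmeas : ∀ j, Measurable (X j)) (hindep : iIndepFun X P)
    (α : ℂ)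
    (hmean : ∀ j, ∫ ω, X j ω ∂P = 0)
    (hsq : ∀ j, ∫ ω, X j ω ^ 2 ∂P = α)
    (hvar : ∀ j, ∫ ω, ‖X j ω‖ ^ 2 ∂P = 1)
    (hLindeberg : ∀ ε : ℝ, 0 < ε →
      Tendsto (fun n : ℕ => (1 / (n : ℝ)) * ∑ j ∈ Finset.range n,
        ∫ ω in {ω | ε * Real.sqrt n < ‖X j ω‖}, ‖X j ω‖ ^ 2 ∂P) atTop (𝓝 0)) :
    -- each `μ_n` is a random measure
    (∀ n : ℕ, Measurable fun ω => RandomCirculant.circulantSpectralMeasure n (fun j => X j ω)) ∧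
    -- weak convergence in expectation
    (∀ f : ℂ →ᵇ ℝ,
      Tendsto (fun n : ℕ =>
          ∫ ω, ∫ z, f z ∂(RandomCirculant.circulantSpectralMeasure n (fun j => X j ω)) ∂P)
        atTop (𝓝 (∫ z, f z ∂(RandomCirculant.complexGaussian)))) ∧
    -- weak convergence in probability
    (∀ f : ℂ →ᵇ ℝ,
      TendstoInMeasure P
        (fun (n : ℕ) ω =>
          ∫ z, f z ∂(RandomCirculant.circulantSpectralMeasure n (fun j => X j ω)))
        atTop (fun _ => ∫ z, f z ∂(RandomCirculant.complexGaussian))) ∧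
    -- first and second moments of `μ_n(A)` for measurable convex sets `A`
    (∀ A : Set ℂ, MeasurableSet A → Convex ℝ A →
      Tendsto (fun n : ℕ =>
          ∫⁻ ω, RandomCirculant.circulantSpectralMeasure n (fun j => X j ω) A ∂P)
        atTop (𝓝 (RandomCirculant.complexGaussian A)) ∧
      Tendsto (fun n : ℕ =>
          ∫⁻ ω, (RandomCirculant.circulantSpectralMeasure n (fun j => X j ω) A) ^ 2 ∂P)
        atTop (𝓝 (RandomCirculant.complexGaussian A ^ 2))) := by
  -- for `n = 0` the spectral measure vanishes, so the sequence of probability measures starts at `1`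
  let ν : ℕ → ProbabilityMeasure (ℂ × ℂ) := fun n =>
    ⟨pairLaw P X (n + 1), isProbabilityMeasure_pairLaw P hmeas n.succ_ne_zero⟩
  let γ₂ : ProbabilityMeasure (ℂ × ℂ) := ⟨complexGaussian.prod complexGaussian, inferInstance⟩
  have hν : Tendsto ν atTop (𝓝 γ₂) := by
    refine tendsto_of_forall_integral_cexp fun s t => ?_
    have hγ : ∫ p, Complex.exp ((inner ℝ p.1 s + inner ℝ p.2 t : ℝ) * Complex.I)
        ∂(γ₂ : Measure (ℂ × ℂ)) = Complex.exp (-((‖s‖ ^ 2 + ‖t‖ ^ 2) / 4 : ℝ)) := by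
      simp only [Complex.ofReal_add, add_mul, Complex.exp_add]
      refine (integral_prod_mul (μ := complexGaussian) (ν := complexGaussian)
        (fun z => Complex.exp ((inner ℝ z s : ℝ) * Complex.I))
        (fun z => Complex.exp ((inner ℝ z t : ℝ) * Complex.I))).trans ?_
      rw [integral_cexp_inner_complexGaussian, integral_cexp_inner_complexGaussian,
        ← Complex.exp_add]
      push_cast
      ring_nf
    rw [hγ]
    exact (tendsto_integral_cexp_pairLaw P hmeas hindep hmean hsq hvar hLindeberg s t).comp
      (tendsto_add_atTop_nat 1)
  have hint : ∀ f g : ℂ →ᵇ ℝ, Tendsto (fun n : ℕ =>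
      ∫ ω, (∫ z, f z ∂circulantSpectralMeasure n (fun j => X j ω)) *
        ∫ z, g z ∂circulantSpectralMeasure n (fun j => X j ω) ∂P) atTop
      (𝓝 ((∫ z, f z ∂complexGaussian) * ∫ z, g z ∂complexGaussian)) := fun f g => by
    rw [← tendsto_add_atTop_iff_nat 1]
    simp only [integral_mul_integral_circulantSpectralMeasure P hmeas]
    rw [← integral_prod_mul]
    exact ProbabilityMeasure.tendsto_iff_forall_integral_tendsto.1 hν
      (f.compContinuous ⟨Prod.fst, continuous_fst⟩ * g.compContinuous ⟨Prod.snd, continuous_snd⟩)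
  have hexp : ∀ f : ℂ →ᵇ ℝ,
      Tendsto (fun n : ℕ => ∫ ω, ∫ z, f z ∂(circulantSpectralMeasure n (fun j => X j ω)) ∂P)
        atTop (𝓝 (∫ z, f z ∂complexGaussian)) := fun f => by
    -- `μ_n` has total mass `1` as soon as `n ≠ 0`, so the constant second factor disappears
    have h := hint f (BoundedContinuousFunction.const ℂ 1)
    simp only [BoundedContinuousFunction.const_apply, integral_const, probReal_univ, smul_eq_mul,
      mul_one] at h
    refine h.congr' ((eventually_ne_atTop 0).mono fun n hn => ?_)
    refine integral_congr_ae (ae_of_all _ fun ω => ?_)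
    have := isProbabilityMeasure_circulantSpectralMeasure hn (fun j => X j ω)
    simp
  have hset : ∀ A B : Set ℂ, MeasurableSet A → MeasurableSet B → Convex ℝ A → Convex ℝ B →
      Tendsto (fun n : ℕ => ∫⁻ ω, circulantSpectralMeasure n (fun j => X j ω) A *
        circulantSpectralMeasure n (fun j => X j ω) B ∂P) atTop
        (𝓝 (complexGaussian A * complexGaussian B)) := fun A B hA hB hcA hcB => by
    rw [← tendsto_add_atTop_iff_nat 1]
    simp only [lintegral_mul_circulantSpectralMeasure P hmeas _ hA hB]
    rw [← Measure.prod_prod]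
    exact ProbabilityMeasure.tendsto_measure_of_null_frontier_of_tendsto' hν
      (complexGaussian_prod_frontier (hcA.prod hcB))
  refine ⟨measurable_circulantSpectralMeasure hmeas, hexp, fun f => ?_, fun A hA hcA => ⟨?_, ?_⟩⟩
  · set S : ℕ → Ω → ℝ := fun n ω => ∫ z, f z ∂circulantSpectralMeasure n (fun j => X j ω) with hS
    have hSm : ∀ n, Measurable (S n) := fun n => by
      simp only [hS, integral_circulantSpectralMeasure]
      have hk : ∀ k : Fin n, Measurable fun ω => f (eigenvalue n (fun j => X j ω) k) := fun k =>
        f.continuous.measurable.comp (measurable_eigenvalue hmeas n k)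
      exact (Finset.measurable_fun_sum _ fun k _ => hk k).const_mul _
    have hSb : ∀ n ω, ‖S n ω‖ ≤ ‖f‖ := fun n ω => by
      simp only [hS, integral_circulantSpectralMeasure]
      rw [norm_mul, norm_inv, Real.norm_natCast]
      rcases Nat.eq_zero_or_pos n with rfl | hn
      · simp
      · rw [inv_mul_le_iff₀ (by exact_mod_cast hn)]
        refine (norm_sum_le _ _).trans ((Finset.sum_le_card_nsmul _ _ ‖f‖ fun k _ =>
          f.norm_coe_le_norm _).trans_eq ?_)
        simp
    exact tendstoInMeasure_const_of_tendsto_integral hSm hSb (hexp f) (hint f f)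
  · have h := hset A Set.univ hA MeasurableSet.univ hcA convex_univ
    rw [measure_univ, mul_one] at h
    refine h.congr' ((eventually_ne_atTop 0).mono fun n hn => lintegral_congr fun ω => ?_)
    have := isProbabilityMeasure_circulantSpectralMeasure hn (fun j => X j ω)
    rw [measure_univ, mul_one]
  · simpa only [pow_two] using hset A A hA hA hcA hcA
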